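/- Let $G$ be a finitely generated group with identity $e$, and let $\mu : G \to [0,\infty)$ be a probability measure on $G$, i.e. $\sum_{g \in G}\mu(g) = 1$. Assume that $\mu$ is non-degenerate, i.e. its support $\{g \in G : \mu(g) > 0\}$ generates $G$ as a semigroup; $\mu$ need be neither symmetric nor finitely supported. For a probability measure $\nu$ on a group $H$ with identity $e_H$, let $\nu^{*n}$ denote its $n$-fold convolution power, where $(\alpha * \beta)(x) = \sum_{s \in H} \alpha(s)\beta(s^{-1}x)$, and put $$\lambda(H,\nu) := \limsup_{n\to\infty} \bigl(\nu^{*n}(e_H)\bigr)^{1/n}.$$ Let $\overline{G} = G^{\mathrm{ab}}/G^{\mathrm{ab}}_{\mathrm{T}}$ be the quotient of the abelianisation $G^{\mathrm{ab}} = G/[G,G]$ by its torsion subgroup $G^{\mathrm{ab}}_{\mathrm{T}}$ (so $\overline{G} \cong \mathbb{Z}^k$ for some $k \ge 0$), let $\pi : G \to \overline{G}$ be the natural projection, and let $\bar\mu = \pi_*\mu$, i.e. $\bar\mu(m) = \sum_{g \in G,\, \pi(g) = m} \mu(g)$. Then $$G \text{ is amenable} \iff \lambda(G,\mu) = \lambda(\overline{G},\bar\mu).$$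 Here $G$ is amenable if there is a linear functional $M : \ell^\infty(G) \to \mathbb{R}$ on the bounded real functions on $G$ such that $M(\mathbf 1) = 1$, $\inf_{g \in G} f(g) \le M(f) \le \sup_{g \in G} f(g)$ for all $f$, and $M(f_g) = M(f)$ for all $f$ and all $g \in G$, where $f_g(x) = f(gx)$. -/

import Mathlib

open Filter
open scoped ENNReal

noncomputable section

namespace RandomWalk

universe u

variable {G : Type u} [Group G]

/-- The left translate `f_g(x) = f(gx)` of a bounded real function `f` on `G`. -/
def leftTranslate (g : G) (f : lp (fun _ : G => ℝ) ∞) : lp (fun _ : G => ℝ) ∞ :=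
  ⟨fun x => f (g * x), memℓp_infty
    (BddAbove.mono (by rintro _ ⟨x, rfl⟩; exact ⟨g * x, rfl⟩)
      (memℓp_infty_iff.mp (lp.memℓp f)))⟩

/-- A group is amenable if it admits a Banach mean: a linear functional on `ℓ^∞(G)` that is
normalised, lies between the infimum and the supremum, and is invariant under translation. -/
def IsAmenable (G : Type u) [Group G] : Prop :=
  ∃ M : lp (fun _ : G => ℝ) ∞ →ₗ[ℝ] ℝ,
    M 1 = 1 ∧
    (∀ f : lp (fun _ : G => ℝ) ∞, (⨅ x, f x) ≤ M f ∧ M f ≤ (⨆ x, f x)) ∧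
    ∀ (g : G) (f : lp (fun _ : G => ℝ) ∞), M (leftTranslate g f) = M f

/-- The convolution `(f ∗ h)(x) = ∑ s, f(s) h(s⁻¹x)` of nonnegative functions on `G`. -/
def conv (f h : G → ℝ≥0∞) (x : G) : ℝ≥0∞ := ∑' s, f s * h (s⁻¹ * x)

/-- The convolution powers; the zeroth power is the unit mass at the identity. -/
def convPow (f : G → ℝ≥0∞) : ℕ → G → ℝ≥0∞
  | 0 => Set.indicator {1} 1
  | n + 1 => conv f (convPow f n)

/-- The spectral radius `λ(G, μ) = limsup_n (μ^{∗n}(e))^{1/n}`. Since `μ^{∗n}(e) ≤ 1`, it lies in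
`[0, 1]`; taking values in `[0, ∞]` makes all sums and the upper limit unconditional. -/
def walkSpectralRadius (μ : PMF G) : ℝ≥0∞ :=
  limsup (fun n : ℕ => convPow μ n 1 ^ (1 / (n : ℝ))) atTop

/-- The support of `μ` generates `G` as a semigroup. -/
def IsNondegenerate (μ : PMF G) : Prop :=
  Subsemigroup.closure μ.support = ⊤

/-- The torsion-free part of the abelianisation: `G^ab` modulo its torsion subgroup. -/
abbrev TorsionFreeAb (G : Type u) [Group G] : Type u :=
  Abelianization G ⧸ CommGroup.torsion (Abelianization G)

/-- The natural projection `π : G → G^ab → G^ab / torsion`. -/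
def proj (G : Type u) [Group G] : G →* TorsionFreeAb G :=
  (QuotientGroup.mk' (CommGroup.torsion (Abelianization G))).comp Abelianization.of

end RandomWalk

end

/-!
The bridge between the two spectral radii is the family of exponential moments
`∑ g, μ(g) e^{φ(g)}`, where `φ` runs over the homomorphisms `G → ℝ`; these are the same as the
homomorphisms `TorsionFreeAb G → ℝ`. Tilting `μ` by `e^φ` does not change return probabilities,
because `φ` vanishes at the identity, so every exponential moment is an upper bound for both spectral
radii (`walkSpectralRadius_le_of_character`).

On an amenable group these bounds are sharp (`exists_character_of_lt`). For `r` above the spectral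
radius the Green function `v = ∑ n, r⁻ⁿ μ^{*n}` is finite, positive and satisfies `μ * v ≤ r v`. By
the Harnack inequality the function `x ↦ log v(g⁻¹x) - log v(x)` is bounded. An invariant mean of it
is additive in `g`, hence a homomorphism `φ`, and Jensen's inequality gives
`∑ g, μ(g) e^{φ(g)} ≤ r`. A compactness argument reaches the spectral radius itself
(`exists_character_le_walkSpectralRadius`).

If `G` is amenable, the sharp bounds for `G` bound the spectral radius of the projected walk by that
of the original one; the other inequality is trivial. Conversely, the torsion-free abelianisation is
always amenable (`isAmenable_of_commGroup`), so some `φ` has exponential moment at most the spectral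
radius of the projected walk. If this equals the spectral radius `λ` of `μ`, then `μ e^φ / λ` is a
subprobability whose return probabilities have exponential rate one, and a non-symmetric form of
Kesten's criterion (`isAmenable_of_one_le_limsup`) makes `G` amenable: the convolution operator `Q` on
`ℓ²(G)` has `‖1 + Q‖ = 2`, nearly extremal unit vectors are nearly translation invariant, and their
squares converge to an invariant mean.
-/

noncomputable section

namespace RandomWalk

universe u

variable {G : Type u} [Group G]

/-! ### Means on bounded functions -/

/-- A linear functional on `ℓ^∞(G)` is a mean if it respects pointwise upper bounds. By linearity
this is the same as being normalised and lying between the infimum and the supremum. -/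
def IsMean {α : Type*} (M : lp (fun _ : α => ℝ) ∞ →ₗ[ℝ] ℝ) : Prop :=
  ∀ (f : lp (fun _ : α => ℝ) ∞) (c : ℝ), (∀ x, f x ≤ c) → M f ≤ c

@[simp]
lemma leftTranslate_apply (g : G) (f : lp (fun _ : G => ℝ) ∞) (x : G) :
    leftTranslate g f x = f (g * x) := rfl

lemma leftTranslate_one (f : lp (fun _ : G => ℝ) ∞) : leftTranslate 1 f = f := by
  ext x; simp

lemma leftTranslate_leftTranslate (g h : G) (f : lp (fun _ : G => ℝ) ∞) :
    leftTranslate g (leftTranslate h f) = leftTranslate (h * g) f := by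
  ext x; simp [mul_assoc]

lemma leftTranslate_add (g : G) (f h : lp (fun _ : G => ℝ) ∞) :
    leftTranslate g (f + h) = leftTranslate g f + leftTranslate g h := by
  ext x; simp

lemma leftTranslate_smul (g : G) (c : ℝ) (f : lp (fun _ : G => ℝ) ∞) :
    leftTranslate g (c • f) = c • leftTranslate g f := by
  ext x; simp

lemma abs_apply_le_norm {α : Type*} (f : lp (fun _ : α => ℝ) ∞) (x : α) : |f x| ≤ ‖f‖ :=
  lp.norm_apply_le_norm (by simp) f x

lemma bddAbove_range {α : Type*} (f : lp (fun _ : α => ℝ) ∞) : BddAbove (Set.range fun x => f x) :=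
  ⟨‖f‖, by rintro _ ⟨x, rfl⟩; exact (le_abs_self _).trans (abs_apply_le_norm f x)⟩

lemma bddBelow_range {α : Type*} (f : lp (fun _ : α => ℝ) ∞) : BddBelow (Set.range fun x => f x) :=
  ⟨-‖f‖, by rintro _ ⟨x, rfl⟩; exact neg_le_of_abs_le (abs_apply_le_norm f x)⟩

namespace IsMean

variable {α : Type*} {M : lp (fun _ : α => ℝ) ∞ →ₗ[ℝ] ℝ}

lemma le_apply (hM : IsMean M) (f : lp (fun _ : α => ℝ) ∞) (c : ℝ) (h : ∀ x, c ≤ f x) :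
    c ≤ M f := by
  have := hM (-f) (-c) (fun x => by simpa using h x)
  rw [map_neg] at this
  linarith

lemma map_one (hM : IsMean M) : M 1 = 1 :=
  le_antisymm (hM 1 1 fun x => by simp [lp.infty_coeFn_one])
    (hM.le_apply 1 1 fun x => by simp [lp.infty_coeFn_one])

lemma abs_le_norm (hM : IsMean M) (f : lp (fun _ : α => ℝ) ∞) : |M f| ≤ ‖f‖ :=
  abs_le.2 ⟨hM.le_apply f _ fun x => neg_le_of_abs_le (abs_apply_le_norm f x),
    hM f _ fun x => (le_abs_self _).trans (abs_apply_le_norm f x)⟩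

/-- A mean invariant under a set of translations that generates the group witnesses
amenability. -/
lemma isAmenable {M : lp (fun _ : G => ℝ) ∞ →ₗ[ℝ] ℝ} (hM : IsMean M) {S : Set G} (hS : Subgroup.closure S = ⊤)
    (hinv : ∀ g ∈ S, ∀ f, M (leftTranslate g f) = M f) : IsAmenable G := by
  refine ⟨M, hM.map_one, fun f => ⟨hM.le_apply f _ fun x => ciInf_le (bddBelow_range f) x,
    hM f _ fun x => le_ciSup (bddAbove_range f) x⟩, fun g => ?_⟩
  have hg : g ∈ Subgroup.closure S := by rw [hS]; trivial
  induction hg using Subgroup.closure_induction with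
  | mem g hg => exact hinv g hg
  | one => intro f; rw [leftTranslate_one]
  | mul a b _ _ ha hb => intro f; rw [← leftTranslate_leftTranslate, hb, ha]
  | inv a _ ha => intro f; rw [← ha, leftTranslate_leftTranslate, inv_mul_cancel, leftTranslate_one]

end IsMean

lemma IsAmenable.exists_isMean (hG : IsAmenable G) :
    ∃ M : lp (fun _ : G => ℝ) ∞ →ₗ[ℝ] ℝ, IsMean M ∧
      ∀ (g : G) (f : lp (fun _ : G => ℝ) ∞), M (leftTranslate g f) = M f := by
  obtain ⟨M, -, hb, hinv⟩ := hG
  exact ⟨M, fun f c h => (hb f).2.trans (ciSup_le h), hinv⟩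

lemma exists_tendsto_ultrafilter {ι : Type*} (U : Ultrafilter ι) {a : ι → ℝ} {C : ℝ}
    (h : ∀ i, |a i| ≤ C) : ∃ l, Tendsto a U (nhds l) := by
  have hK : IsCompact (Set.Icc (-C) C) := isCompact_Icc
  obtain ⟨l, -, hl⟩ := hK.ultrafilter_le_nhds (U.map a)
    (by rw [Ultrafilter.coe_map, le_principal_iff, mem_map]
        exact univ_mem' fun i => abs_le.1 (h i))
  exact ⟨l, hl⟩

/-- Weak-* compactness of the set of means: for a sequence of means there is a mean agreeing with
its limit at every function where the limit exists. -/
lemma exists_isMean_limit {α : Type*} (m : ℕ → lp (fun _ : α => ℝ) ∞ →ₗ[ℝ] ℝ) (hm : ∀ n, IsMean (m n)) :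
    ∃ M : lp (fun _ : α => ℝ) ∞ →ₗ[ℝ] ℝ, IsMean M ∧
      ∀ f c, Tendsto (fun n => m n f) atTop (nhds c) → M f = c := by
  choose L hL using fun f : lp (fun _ : α => ℝ) ∞ =>
    exists_tendsto_ultrafilter (hyperfilter ℕ) (fun n => (hm n).abs_le_norm f)
  refine ⟨{ toFun := L, map_add' := fun f g => ?_, map_smul' := fun c f => ?_ }, ?_, ?_⟩
  · exact tendsto_nhds_unique (hL _) (by simpa using (hL f).add (hL g))
  · exact tendsto_nhds_unique (hL _) (by simpa using (hL f).const_mul c)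
  · intro f c h
    exact le_of_tendsto (hL f) (Eventually.of_forall fun n => hm n f c h)
  · intro f c h
    exact tendsto_nhds_unique (hL f) (h.mono_left Nat.hyperfilter_le_atTop)

/-! ### Amenability of finitely generated commutative groups -/

/-- The mean `f ↦ m (f_g)`. -/
def translateMean (m : lp (fun _ : G => ℝ) ∞ →ₗ[ℝ] ℝ) (g : G) :
    lp (fun _ : G => ℝ) ∞ →ₗ[ℝ] ℝ where
  toFun f := m (leftTranslate g f)
  map_add' f h := by rw [leftTranslate_add, map_add]
  map_smul' c f := by rw [leftTranslate_smul, map_smul]; rfl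

/-- The generators are treated one at a time: averaging a mean over the powers of a new generator
`s` and passing to a generalised limit makes it `s`-invariant, and the invariance under the previous
generators survives because they commute with `s`. -/
lemma exists_isMean_invariant_finset {A : Type u} [CommGroup A] (S : Finset A) :
    ∃ M : lp (fun _ : A => ℝ) ∞ →ₗ[ℝ] ℝ, IsMean M ∧
      ∀ g ∈ S, ∀ f, M (leftTranslate g f) = M f := by
  classical
  induction S using Finset.induction_on with
  | empty =>
    refine ⟨{ toFun := fun f => f 1, map_add' := fun _ _ => rfl, map_smul' := fun _ _ => rfl },
      fun f c h => h 1, by simp⟩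
  | insert s S _ ih =>
    obtain ⟨m, hm, hinv⟩ := ih
    set a : ℕ → lp (fun _ : A => ℝ) ∞ →ₗ[ℝ] ℝ := fun n =>
      ((n : ℝ) + 1)⁻¹ • ∑ j ∈ Finset.range (n + 1), translateMean m (s ^ j) with ha
    have haf : ∀ n f, a n f =
        ((n : ℝ) + 1)⁻¹ * ∑ j ∈ Finset.range (n + 1), m (leftTranslate (s ^ j) f) := by
      intro n f
      simp [ha, translateMean]
    have hmean : ∀ n, IsMean (a n) := by
      intro n f c h
      rw [haf, inv_mul_le_iff₀ (by positivity)]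
      calc ∑ j ∈ Finset.range (n + 1), m (leftTranslate (s ^ j) f)
          ≤ ∑ j ∈ Finset.range (n + 1), c :=
            Finset.sum_le_sum fun j _ => hm (leftTranslate (s ^ j) f) c fun x => h _
        _ = ((n : ℝ) + 1) * c := by simp
    obtain ⟨M, hM, hlim⟩ := exists_isMean_limit a hmean
    refine ⟨M, hM, fun g hg f => ?_⟩
    rw [← sub_eq_zero, ← map_sub]
    apply hlim
    rcases Finset.mem_insert.1 hg with rfl | hg
    · -- the average telescopes
      have key : ∀ n, |a n (leftTranslate g f - f)| ≤ 2 * ‖f‖ * (1 / ((n : ℝ) + 1)) := by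
        intro n
        have h1 : a n (leftTranslate g f - f) = ((n : ℝ) + 1)⁻¹ *
            (m (leftTranslate (g ^ (n + 1)) f) - m f) := by
          rw [map_sub, haf, haf, ← mul_sub, ← Finset.sum_sub_distrib]
          have := Finset.sum_range_sub (fun j => m (leftTranslate (g ^ j) f)) (n + 1)
          rw [pow_zero, leftTranslate_one] at this
          rw [← this]
          simp_rw [leftTranslate_leftTranslate, ← pow_succ']
        have h2 : |m (leftTranslate (g ^ (n + 1)) f)| ≤ ‖f‖ := abs_le.2
          ⟨hm.le_apply _ _ fun x => neg_le_of_abs_le (abs_apply_le_norm f _),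
            hm _ _ fun x => (le_abs_self _).trans (abs_apply_le_norm f _)⟩
        have h3 := hm.abs_le_norm f
        rw [h1, abs_mul, abs_of_pos (by positivity : (0 : ℝ) < ((n : ℝ) + 1)⁻¹), mul_comm,
          one_div]
        gcongr
        linarith [abs_sub (m (leftTranslate (g ^ (n + 1)) f)) (m f)]
      refine squeeze_zero_norm key ?_
      simpa using tendsto_one_div_add_atTop_nhds_zero_nat.const_mul (2 * ‖f‖)
    · have : ∀ n, a n (leftTranslate g f - f) = 0 := by
        intro n
        rw [map_sub, haf, haf, sub_eq_zero]
        congr 1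
        refine Finset.sum_congr rfl fun j _ => ?_
        rw [leftTranslate_leftTranslate, mul_comm, ← leftTranslate_leftTranslate, hinv g hg]
      simp [this]

lemma isAmenable_of_commGroup (A : Type u) [CommGroup A] [Group.FG A] : IsAmenable A := by
  obtain ⟨S, hS⟩ := Group.fg_def.1 (inferInstance : Group.FG A)
  obtain ⟨M, hM, hinv⟩ := exists_isMean_invariant_finset S
  exact hM.isAmenable hS hinv

/-! ### Convolution operators on `ℓ²(G)` -/

/-- Left translation on `ℓ²(G)`, `(L_s ξ)(x) = ξ(s⁻¹x)`. -/
def shift (s : G) : lp (fun _ : G => ℝ) 2 →ₗᵢ[ℝ] lp (fun _ : G => ℝ) 2 where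
  toFun ξ := ⟨fun x => ξ (s⁻¹ * x), memℓp_gen
    (((lp.memℓp ξ).summable (by simp)).comp_injective (Equiv.mulLeft s⁻¹).injective)⟩
  map_add' _ _ := rfl
  map_smul' _ _ := rfl
  norm_map' ξ := by
    rw [lp.norm_eq_tsum_rpow (by simp), lp.norm_eq_tsum_rpow (by simp)]
    congr 1
    exact (Equiv.mulLeft s⁻¹).tsum_eq fun x => ‖ξ x‖ ^ (2 : ℝ≥0∞).toReal

@[simp]
lemma shift_apply (s : G) (ξ : lp (fun _ : G => ℝ) 2) (x : G) : shift s ξ x = ξ (s⁻¹ * x) := rfl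

/-- The operator `ξ ↦ q * ξ` of left convolution by a summable function `q`. -/
def convOp (q : G → ℝ) : lp (fun _ : G => ℝ) 2 →L[ℝ] lp (fun _ : G => ℝ) 2 :=
  ∑' s, q s • (shift s).toContinuousLinearMap

lemma norm_smul_shift_le {q : G → ℝ} (hq0 : ∀ s, 0 ≤ q s) (s : G) :
    ‖q s • (shift s).toContinuousLinearMap‖ ≤ q s := by
  rw [norm_smul, Real.norm_of_nonneg (hq0 s)]
  exact mul_le_of_le_one_right (hq0 s) (LinearIsometry.norm_toContinuousLinearMap_le _)

lemma norm_convOp_le {q : G → ℝ} (hq0 : ∀ s, 0 ≤ q s) (hq : Summable q) :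
    ‖convOp q‖ ≤ ∑' s, q s :=
  tsum_of_norm_bounded hq.hasSum (norm_smul_shift_le hq0)

lemma hasSum_convOp {q : G → ℝ} (hq0 : ∀ s, 0 ≤ q s) (hq : Summable q)
    (ξ : lp (fun _ : G => ℝ) 2) : HasSum (fun s => q s • shift s ξ) (convOp q ξ) := by
  have h : Summable fun s => q s • (shift s).toContinuousLinearMap :=
    Summable.of_norm_bounded hq (norm_smul_shift_le hq0)
  exact h.hasSum.mapL (ContinuousLinearMap.apply ℝ _ ξ)

lemma hasSum_convOp_apply {q : G → ℝ} (hq0 : ∀ s, 0 ≤ q s) (hq : Summable q)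
    (ξ : lp (fun _ : G => ℝ) 2) (x : G) :
    HasSum (fun s => q s * ξ (s⁻¹ * x)) (convOp q ξ x) := by
  have hc : Continuous fun η : lp (fun _ : G => ℝ) 2 => η x :=
    (lp.lipschitzWith_one_eval 2 x).continuous
  exact (hasSum_convOp hq0 hq ξ).map
    ({ toFun := fun η => η x, map_zero' := rfl, map_add' := fun _ _ => rfl } :
      lp (fun _ : G => ℝ) 2 →+ ℝ) hc

lemma convPow_le_one {f : G → ℝ≥0∞} (hf : ∑' s, f s ≤ 1) (n : ℕ) (x : G) :
    convPow f n x ≤ 1 := by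
  induction n generalizing x with
  | zero => exact Set.indicator_le_self' (by simp) x
  | succ n ih =>
    calc ∑' s, f s * convPow f n (s⁻¹ * x) ≤ ∑' s, f s :=
          ENNReal.tsum_le_tsum fun s => mul_le_of_le_one_right' (ih _)
      _ ≤ 1 := hf

lemma convOp_pow_single [DecidableEq G] {f : G → ℝ≥0∞} (hf : ∑' s, f s ≤ 1) (n : ℕ) (x : G) :
    ((convOp fun s => (f s).toReal) ^ n) (lp.single 2 1 1) x = (convPow f n x).toReal := by
  have hfin : ∑' s, f s ≠ ∞ := (hf.trans_lt ENNReal.one_lt_top).ne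
  induction n generalizing x with
  | zero =>
    by_cases hx : x = 1
    · subst hx; simp [convPow]
    · simp [convPow, lp.single_apply, hx]
  | succ n ih =>
    rw [pow_succ', mul_apply_eq_comp,
      ← (hasSum_convOp_apply (fun s => ENNReal.toReal_nonneg) (ENNReal.summable_toReal hfin)
        _ x).tsum_eq]
    simp_rw [ih, ← ENNReal.toReal_mul]
    rw [convPow, conv, ENNReal.tsum_toReal_eq]
    exact fun s => ENNReal.mul_ne_top (ENNReal.ne_top_of_tsum_ne_top hfin s)
      ((convPow_le_one hf n _).trans_lt ENNReal.one_lt_top).ne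

/-- The middle term in the binomial expansion of `(1 + Q) ^ (2 * k)`, where `Q` is convolution by
`f`, bounds the return probability at time `k`. -/
lemma choose_mul_convPow_le {f : G → ℝ≥0∞} (hf : ∑' s, f s ≤ 1) (k : ℕ) :
    (k.centralBinom : ℝ) * (convPow f k 1).toReal ≤
      ‖1 + convOp fun s => (f s).toReal‖ ^ (2 * k) := by
  classical
  set Q := convOp fun s => (f s).toReal
  set δ : lp (fun _ : G => ℝ) 2 := lp.single 2 1 1
  have h1 : ((1 + Q) ^ (2 * k)) δ 1 =
      ∑ m ∈ Finset.range (2 * k + 1), ((2 * k).choose m : ℝ) * (convPow f m 1).toReal := by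
    rw [add_comm, (Commute.one_right Q).add_pow, sum_apply, lp.coeFn_sum,
      Finset.sum_apply]
    refine Finset.sum_congr rfl fun m _ => ?_
    rw [one_pow, mul_one, ← convOp_pow_single hf, ← nsmul_eq_mul', smul_apply,
      ← Nat.cast_smul_eq_nsmul ℝ, lp.coeFn_smul, Pi.smul_apply, smul_eq_mul]
  have hδ : ‖δ‖ = 1 := by rw [lp.norm_single two_pos, norm_one]
  have : Nontrivial (lp (fun _ : G => ℝ) 2) := ⟨δ, 0, fun h => by simp [h] at hδ⟩
  calc (k.centralBinom : ℝ) * (convPow f k 1).toReal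
      ≤ ∑ m ∈ Finset.range (2 * k + 1), ((2 * k).choose m : ℝ) * (convPow f m 1).toReal :=
        Finset.single_le_sum (f := fun m => ((2 * k).choose m : ℝ) * (convPow f m 1).toReal)
          (fun m _ => by positivity) (Finset.mem_range.2 (by omega))
    _ = ((1 + Q) ^ (2 * k)) δ 1 := h1.symm
    _ ≤ ‖((1 + Q) ^ (2 * k)) δ‖ :=
        (le_abs_self _).trans (lp.norm_apply_le_norm (p := 2) two_ne_zero (((1 + Q) ^ (2 * k)) δ) 1)
    _ ≤ ‖(1 + Q) ^ (2 * k)‖ * ‖δ‖ := ContinuousLinearMap.le_opNorm _ _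
    _ ≤ ‖1 + Q‖ ^ (2 * k) := by
        rw [hδ, mul_one]
        exact norm_pow_le _ _

/-- A subprobability with exponential return rate `1` has `‖1 + Q‖ = 2`. Passing to `1 + Q`
rather than `Q` is what makes the almost invariant vectors below invariant under the support itself
and not only under quotients of its elements. -/
lemma two_le_norm_one_add_convOp {f : G → ℝ≥0∞} (hf : ∑' s, f s ≤ 1)
    (hlim : 1 ≤ limsup (fun n : ℕ => convPow f n 1 ^ (1 / (n : ℝ))) atTop) :
    2 ≤ ‖1 + convOp fun s => (f s).toReal‖ := by
  by_contra! hlt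
  set ρ := ‖1 + convOp fun s => (f s).toReal‖ / 2 with hρ
  have hρ0 : 0 ≤ ρ := by positivity
  have hρ1 : ρ ^ 2 < 1 := pow_lt_one₀ hρ0 (by rw [hρ]; linarith) two_ne_zero
  obtain ⟨σ, hσρ, hσ1⟩ := exists_between hρ1
  have hσ0 : 0 < σ := (sq_nonneg ρ).trans_lt hσρ
  have ht : Tendsto (fun k : ℕ => 2 * ((k : ℝ) * (ρ ^ 2 / σ) ^ k)) atTop (nhds (2 * 0)) :=
    (tendsto_self_mul_const_pow_of_lt_one (by positivity)
      ((div_lt_one hσ0).2 hσρ)).const_mul 2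
  rw [mul_zero] at ht
  have hev : ∀ᶠ k : ℕ in atTop, convPow f k 1 ^ (1 / (k : ℝ)) ≤ ENNReal.ofReal σ := by
    filter_upwards [ht.eventually_le_const zero_lt_one, eventually_gt_atTop 0] with k hk hk0
    have hfin : convPow f k 1 ≠ ∞ := ((convPow_le_one hf k 1).trans_lt ENNReal.one_lt_top).ne
    have h1 := choose_mul_convPow_le hf k
    have h2 : (4 : ℝ) ^ k ≤ 2 * k * k.centralBinom := by
      exact_mod_cast Nat.four_pow_le_two_mul_self_mul_centralBinom k hk0
    have h3 : ‖1 + convOp fun s => (f s).toReal‖ ^ (2 * k) = 4 ^ k * (ρ ^ 2) ^ k := by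
      rw [pow_mul, ← mul_pow, hρ]; ring
    have h4 : (convPow f k 1).toReal ≤ σ ^ k := by
      have hp : 0 ≤ (convPow f k 1).toReal := ENNReal.toReal_nonneg
      have h5 : (4 : ℝ) ^ k * (convPow f k 1).toReal ≤ 4 ^ k * (2 * k * (ρ ^ 2) ^ k) := by
        calc (4 : ℝ) ^ k * (convPow f k 1).toReal
            ≤ 2 * k * k.centralBinom * (convPow f k 1).toReal := by gcongr
          _ = 2 * k * (k.centralBinom * (convPow f k 1).toReal) := by ring
          _ ≤ 2 * k * (4 ^ k * (ρ ^ 2) ^ k) := by rw [← h3]; gcongr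
          _ = _ := by ring
      refine (le_of_mul_le_mul_left h5 (by positivity)).trans ?_
      rw [div_pow] at hk
      have hσk : 0 < σ ^ k := by positivity
      calc 2 * k * (ρ ^ 2) ^ k = 2 * (k * ((ρ ^ 2) ^ k / σ ^ k)) * σ ^ k := by field_simp
        _ ≤ 1 * σ ^ k := by gcongr
        _ = σ ^ k := one_mul _
    rw [one_div, ENNReal.rpow_inv_le_iff (by exact_mod_cast hk0), ENNReal.rpow_natCast,
      ← ENNReal.ofReal_pow hσ0.le]
    exact (ENNReal.le_ofReal_iff_toReal_le hfin (by positivity)).2 h4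
  have : (1 : ℝ≥0∞) ≤ ENNReal.ofReal σ := hlim.trans (limsup_le_of_le (h := hev))
  rw [ENNReal.one_le_ofReal] at this
  linarith

/-! ### Kesten's criterion: return rate one implies amenability -/

lemma hasSum_sq {α : Type*} (ξ : lp (fun _ : α => ℝ) 2) : HasSum (fun x => ξ x ^ 2) (‖ξ‖ ^ 2) := by
  have := lp.hasSum_inner (𝕜 := ℝ) ξ ξ
  rw [real_inner_self_eq_norm_sq] at this
  simpa [← pow_two] using this

lemma summable_sq_mul {α : Type*} (ξ : lp (fun _ : α => ℝ) 2) (f : lp (fun _ : α => ℝ) ∞) :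
    Summable fun x => ξ x ^ 2 * f x := by
  refine Summable.of_norm_bounded ((hasSum_sq ξ).summable.mul_right ‖f‖) fun x => ?_
  rw [norm_mul, Real.norm_of_nonneg (sq_nonneg _)]
  gcongr
  exact abs_apply_le_norm f x

/-- The functional `f ↦ ∑ x, ξ(x)² f(x)` attached to a vector of `ℓ²(G)`. -/
def sqMean {α : Type*} (ξ : lp (fun _ : α => ℝ) 2) : lp (fun _ : α => ℝ) ∞ →ₗ[ℝ] ℝ where
  toFun f := ∑' x, ξ x ^ 2 * f x
  map_add' f g := by
    rw [← (summable_sq_mul ξ f).tsum_add (summable_sq_mul ξ g)]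
    exact tsum_congr fun x => mul_add _ _ _
  map_smul' c f := by
    rw [RingHom.id_apply, smul_eq_mul, ← tsum_mul_left]
    exact tsum_congr fun x => mul_left_comm _ _ _

lemma sqMean_apply {α : Type*} (ξ : lp (fun _ : α => ℝ) 2) (f : lp (fun _ : α => ℝ) ∞) :
    sqMean ξ f = ∑' x, ξ x ^ 2 * f x := rfl

lemma isMean_sqMean {α : Type*} {ξ : lp (fun _ : α => ℝ) 2} (hξ : ‖ξ‖ = 1) : IsMean (sqMean ξ) := by
  intro f c h
  have h1 := (hasSum_sq ξ).mul_right c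
  rw [hξ, one_pow, one_mul] at h1
  exact hasSum_le (fun x => mul_le_mul_of_nonneg_left (h x) (sq_nonneg _))
    (summable_sq_mul ξ f).hasSum h1

lemma sqMean_leftTranslate (ξ : lp (fun _ : G => ℝ) 2) (s : G) (f : lp (fun _ : G => ℝ) ∞) :
    sqMean ξ (leftTranslate s f) = sqMean (shift s ξ) f := by
  rw [sqMean_apply, sqMean_apply,
    ← (Equiv.mulLeft s).tsum_eq fun x => shift s ξ x ^ 2 * f x]
  simp

lemma abs_sqMean_sub_le {α : Type*} (ξ η : lp (fun _ : α => ℝ) 2) (f : lp (fun _ : α => ℝ) ∞) :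
    |sqMean ξ f - sqMean η f| ≤ ‖f‖ * (‖ξ - η‖ * ‖ξ + η‖) := by
  have hc : (2 : ℝ≥0∞).toReal.HolderConjugate (2 : ℝ≥0∞).toReal := by
    simpa using Real.HolderConjugate.two_two
  have hs := (lp.summable_mul hc (ξ - η) (ξ + η)).mul_left ‖f‖
  rw [sqMean_apply, sqMean_apply, ← (summable_sq_mul ξ f).tsum_sub (summable_sq_mul η f)]
  refine (tsum_of_norm_bounded (E := ℝ) hs.hasSum fun x => ?_).trans ?_
  · have : ξ x ^ 2 * f x - η x ^ 2 * f x = f x * ((ξ - η) x * (ξ + η) x) := by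
      simp only [lp.coeFn_sub, lp.coeFn_add, Pi.sub_apply, Pi.add_apply]; ring
    rw [this, norm_mul, norm_mul]
    gcongr
    exact abs_apply_le_norm f x
  · rw [tsum_mul_left]
    gcongr
    exact lp.tsum_mul_le_mul_norm' hc (ξ - η) (ξ + η)

/-- A unit vector nearly extremal for `1 + Q` is nearly fixed by every translation charged
by `q`. -/
lemma exists_almost_invariant {q : G → ℝ} (hq0 : ∀ s, 0 ≤ q s) (hq : Summable q)
    (hq1 : ∑' s, q s ≤ 1) (hnorm : 2 ≤ ‖1 + convOp q‖) {ε : ℝ} (hε : 0 < ε) :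
    ∃ ξ : lp (fun _ : G => ℝ) 2, ‖ξ‖ = 1 ∧
      ∀ s, q s * ‖shift s ξ - ξ‖ ^ 2 ≤ ε := by
  obtain ⟨δ, hδ0, hδ1, hδε⟩ : ∃ δ : ℝ, 0 < δ ∧ δ ≤ 1 ∧ 4 * δ ≤ ε :=
    ⟨min 1 (ε / 4), by positivity, min_le_left _ _, by linarith [min_le_right 1 (ε / 4)]⟩
  obtain ⟨x, hx⟩ := (1 + convOp q).exists_mul_lt_of_lt_opNorm (r := 2 - δ) (by linarith)
    (by linarith)
  have hx0 : x ≠ 0 := by rintro rfl; simp at hx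
  have hxn : 0 < ‖x‖ := norm_pos_iff.2 hx0
  set ξ : lp (fun _ : G => ℝ) 2 := ‖x‖⁻¹ • x
  have hξ : ‖ξ‖ = 1 := by
    rw [norm_smul, norm_inv, norm_norm, inv_mul_cancel₀ hxn.ne']
  have hlow : 2 - δ ≤ ‖ξ + convOp q ξ‖ := by
    have : ξ + convOp q ξ = ‖x‖⁻¹ • ((1 + convOp q) x) := by simp [ξ]
    rw [this, norm_smul, norm_inv, norm_norm, le_inv_mul_iff₀ hxn, mul_comm]
    exact hx.le
  have hQ : ‖convOp q ξ‖ ≤ 1 := by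
    have := (convOp q).le_of_opNorm_le ((norm_convOp_le hq0 hq).trans hq1) ξ
    rwa [hξ, one_mul] at this
  have hin : 1 - 2 * δ ≤ inner ℝ ξ (convOp q ξ) := by
    have h1 := norm_add_sq_real ξ (convOp q ξ)
    rw [hξ] at h1
    nlinarith [norm_nonneg (convOp q ξ)]
  have hsum : HasSum (fun s => q s * inner ℝ ξ (shift s ξ)) (inner ℝ ξ (convOp q ξ)) := by
    simpa [inner_smul_right] using (hasSum_convOp hq0 hq ξ).mapL (innerSL ℝ ξ)
  have hsq : ∀ s, ‖shift s ξ - ξ‖ ^ 2 = 2 * (1 - inner ℝ ξ (shift s ξ)) := by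
    intro s
    rw [norm_sub_sq_real, LinearIsometry.norm_map, hξ, real_inner_comm]; ring
  refine ⟨ξ, hξ, fun s => ?_⟩
  have hle : q s * (1 - inner ℝ ξ (shift s ξ)) ≤ 2 * δ := by
    have h2 : HasSum (fun s => q s * (1 - inner ℝ ξ (shift s ξ)))
        (∑' s, q s - inner ℝ ξ (convOp q ξ)) := by
      simpa [mul_sub] using hq.hasSum.sub hsum
    refine (le_hasSum h2 s fun t _ => mul_nonneg (hq0 t) ?_).trans (by linarith)
    have := hsq t ▸ sq_nonneg ‖shift t ξ - ξ‖
    linarith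
  rw [hsq]
  linarith

/-- Kesten's criterion without symmetry: a subprobability whose support generates the group and
whose return probabilities have exponential rate at least one forces amenability. -/
theorem isAmenable_of_one_le_limsup {f : G → ℝ≥0∞} (hf : ∑' s, f s ≤ 1)
    (hgen : Subgroup.closure (Function.support f) = ⊤)
    (hlim : 1 ≤ limsup (fun n : ℕ => convPow f n 1 ^ (1 / (n : ℝ))) atTop) :
    IsAmenable G := by
  have hfin : ∑' s, f s ≠ ∞ := (hf.trans_lt ENNReal.one_lt_top).ne
  have hfin' := ENNReal.ne_top_of_tsum_ne_top hfin
  set q : G → ℝ := fun s => (f s).toReal with hqdef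
  have hq0 : ∀ s, 0 ≤ q s := fun s => ENNReal.toReal_nonneg
  have hq : Summable q := ENNReal.summable_toReal hfin
  have hq1 : ∑' s, q s ≤ 1 := by
    rw [← ENNReal.tsum_toReal_eq hfin']
    exact ENNReal.toReal_le_of_le_ofReal zero_le_one (by simpa using hf)
  choose ξ hξ hinv using fun n : ℕ => exists_almost_invariant hq0 hq hq1
    (two_le_norm_one_add_convOp hf hlim) (ε := 1 / ((n : ℝ) + 1)) (by positivity)
  obtain ⟨M, hM, hMlim⟩ := exists_isMean_limit (fun n => sqMean (ξ n))
    fun n => isMean_sqMean (hξ n)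
  refine hM.isAmenable hgen fun s hs g => ?_
  rw [← sub_eq_zero, ← map_sub]
  apply hMlim
  have hqs : 0 < q s := ENNReal.toReal_pos hs (hfin' s)
  have hsq : Tendsto (fun n => ‖shift s (ξ n) - ξ n‖ ^ 2) atTop (nhds 0) := by
    refine squeeze_zero (fun n => sq_nonneg _)
      (g := fun n : ℕ => (q s)⁻¹ * (1 / ((n : ℝ) + 1))) (fun n => ?_) ?_
    · rw [le_inv_mul_iff₀ hqs]; exact hinv n s
    · simpa using tendsto_one_div_add_atTop_nhds_zero_nat.const_mul (q s)⁻¹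
  have hn : Tendsto (fun n => ‖shift s (ξ n) - ξ n‖) atTop (nhds 0) := by
    simpa using hsq.sqrt
  refine squeeze_zero_norm (a := fun n => ‖g‖ * (‖shift s (ξ n) - ξ n‖ * 2)) (fun n => ?_) ?_
  · rw [map_sub, sqMean_leftTranslate]
    refine (abs_sqMean_sub_le _ _ _).trans ?_
    gcongr
    refine (norm_add_le _ _).trans ?_
    rw [LinearIsometry.norm_map, hξ]; norm_num
  · simpa using (hn.mul_const 2).const_mul ‖g‖

/-! ### Positive superharmonic functions -/

/-- Harnack inequality: for nondegenerate `μ`, the translates of a superharmonic function are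
comparable, uniformly in the base point. -/
lemma exists_harnack {μ : PMF G} (hμ : IsNondegenerate μ) {r : ℝ≥0∞} (hr : r ≠ ∞)
    {v : G → ℝ≥0∞} (hv : ∀ x, ∑' s, μ s * v (s⁻¹ * x) ≤ r * v x) (g : G) :
    ∃ c : ℝ≥0∞, c ≠ ∞ ∧ ∀ x, v (g⁻¹ * x) ≤ c * v x := by
  have hg : g ∈ Subsemigroup.closure μ.support := by rw [hμ]; trivial
  induction hg using Subsemigroup.closure_induction with
  | mem s hs =>
    have hs0 : μ s ≠ 0 := (μ.mem_support_iff s).1 hs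
    refine ⟨(μ s)⁻¹ * r, ENNReal.mul_ne_top (ENNReal.inv_ne_top.2 hs0) hr, fun x => ?_⟩
    rw [mul_assoc, ← ENNReal.div_eq_inv_mul, ENNReal.le_div_iff_mul_le (Or.inl hs0)
      (Or.inl (μ.apply_ne_top s)), mul_comm]
    exact (ENNReal.le_tsum s).trans (hv x)
  | mul a b _ _ ha hb =>
    obtain ⟨c, hc, ha⟩ := ha
    obtain ⟨d, hd, hb⟩ := hb
    refine ⟨d * c, ENNReal.mul_ne_top hd hc, fun x => ?_⟩
    rw [mul_inv_rev, mul_assoc, mul_assoc]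
    exact (hb _).trans (by gcongr; exact ha x)

/-- The Green function `∑ n, r⁻ⁿ μ^{*n}(x)`. -/
def green (μ : PMF G) (r : ℝ≥0∞) (x : G) : ℝ≥0∞ := ∑' n : ℕ, convPow μ n x * r⁻¹ ^ n

lemma tsum_mul_green_le (μ : PMF G) {r : ℝ≥0∞} (hr0 : r ≠ 0) (hr : r ≠ ∞) (x : G) :
    ∑' s, μ s * green μ r (s⁻¹ * x) ≤ r * green μ r x := by
  calc ∑' s, μ s * green μ r (s⁻¹ * x)
      = ∑' s, ∑' n : ℕ, μ s * convPow μ n (s⁻¹ * x) * r⁻¹ ^ n := by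
        simp_rw [green, ← ENNReal.tsum_mul_left, mul_assoc]
    _ = ∑' n : ℕ, convPow μ (n + 1) x * r⁻¹ ^ n := by
        rw [ENNReal.tsum_comm]
        simp_rw [ENNReal.tsum_mul_right]
        rfl
    _ = r * ∑' n : ℕ, convPow μ (n + 1) x * r⁻¹ ^ (n + 1) := by
        rw [← ENNReal.tsum_mul_left]
        refine tsum_congr fun n => ?_
        rw [pow_succ, mul_left_comm, mul_left_comm r, ENNReal.mul_inv_cancel hr0 hr, mul_one]
    _ ≤ r * green μ r x := by
        gcongr
        exact ENNReal.tsum_comp_le_tsum_of_injective (add_left_injective 1)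
          fun n : ℕ => convPow μ n x * r⁻¹ ^ n

lemma green_one_ne_top {μ : PMF G} {r : ℝ≥0∞} (h : walkSpectralRadius μ < r) :
    green μ r 1 ≠ ∞ := by
  obtain ⟨t, ht, htr⟩ := exists_between h
  have htt : t ≠ ∞ := htr.ne_top
  obtain ⟨N, hN⟩ := eventually_atTop.1 (eventually_lt_of_limsup_lt ht)
  have hr0 : r ≠ 0 := (pos_of_gt h).ne'
  have hfin : ∀ n, convPow μ n 1 * r⁻¹ ^ n ≠ ∞ := fun n => ENNReal.mul_ne_top
    ((convPow_le_one μ.tsum_coe.le n 1).trans_lt ENNReal.one_lt_top).ne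
    (ENNReal.pow_ne_top (ENNReal.inv_ne_top.2 hr0))
  rw [green, ← ENNReal.summable.sum_add_tsum_nat_add' (k := N + 1)]
  refine ENNReal.add_ne_top.2 ⟨ENNReal.sum_ne_top.2 fun n _ => hfin n, ?_⟩
  have hle : ∀ n : ℕ, convPow μ (n + (N + 1)) 1 * r⁻¹ ^ (n + (N + 1)) ≤ (t / r) ^ n := by
    intro n
    have hn := (hN (n + (N + 1)) (by omega)).le
    rw [one_div, ENNReal.rpow_inv_le_iff (by positivity), ENNReal.rpow_natCast] at hn
    have hq1 : t / r ≤ 1 := ENNReal.div_le_of_le_mul (by simpa using htr.le)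
    calc _ ≤ t ^ (n + (N + 1)) * r⁻¹ ^ (n + (N + 1)) := by gcongr
      _ = (t / r) ^ (n + (N + 1)) := by rw [← mul_pow, div_eq_mul_inv]
      _ ≤ (t / r) ^ n := pow_le_pow_right_of_le_one' hq1 (by omega)
  refine ((ENNReal.tsum_le_tsum hle).trans_lt ?_).ne
  rw [ENNReal.tsum_geometric, ENNReal.inv_lt_top, tsub_pos_iff_lt]
  exact ENNReal.div_lt_of_lt_mul (by simpa using htr)

/-- Above the spectral radius the Green function is a positive finite superharmonic function. -/
lemma exists_superharmonic {μ : PMF G} (hμ : IsNondegenerate μ) {r : ℝ≥0∞} (hr : r ≠ ∞)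
    (h : walkSpectralRadius μ < r) :
    ∃ v : G → ℝ≥0∞, (∀ x, v x ≠ 0 ∧ v x ≠ ∞) ∧ ∀ x, ∑' s, μ s * v (s⁻¹ * x) ≤ r * v x := by
  have hv := tsum_mul_green_le μ (pos_of_gt h).ne' hr
  have h1 : green μ r 1 ≠ 0 := by
    refine (zero_lt_one.trans_le ?_).ne'
    refine le_trans ?_ (ENNReal.le_tsum 0)
    simp [convPow]
  refine ⟨green μ r, fun x => ⟨fun h0 => ?_, ?_⟩, hv⟩
  · obtain ⟨c, -, hc⟩ := exists_harnack hμ hr hv x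
    have := hc x
    rw [inv_mul_cancel, h0, mul_zero, nonpos_iff_eq_zero] at this
    exact h1 this
  · obtain ⟨c, hc, hcx⟩ := exists_harnack hμ hr hv x⁻¹
    have := hcx 1
    rw [inv_inv, mul_one] at this
    exact (this.trans_lt (ENNReal.mul_lt_top hc.lt_top (green_one_ne_top h).lt_top)).ne

/-! ### Exponential weights on amenable groups -/

/-- The weight `e^φ` of a real additive character `φ`. -/
def expWeight (φ : G →* Multiplicative ℝ) (g : G) : ℝ≥0∞ :=
  ENNReal.ofReal (Real.exp (φ g).toAdd)

lemma expWeight_one (φ : G →* Multiplicative ℝ) : expWeight φ 1 = 1 := by simp [expWeight]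

lemma expWeight_mul (φ : G →* Multiplicative ℝ) (a b : G) :
    expWeight φ (a * b) = expWeight φ a * expWeight φ b := by
  rw [expWeight, map_mul, toAdd_mul, Real.exp_add, ENNReal.ofReal_mul (Real.exp_pos _).le]; rfl

lemma expWeight_ne_zero (φ : G →* Multiplicative ℝ) (g : G) : expWeight φ g ≠ 0 := by
  simp [expWeight, Real.exp_pos]

lemma tsum_mul_expWeight_le_iff {f : G → ℝ≥0∞} (hf : ∀ s, f s ≠ ∞) (φ : G →* Multiplicative ℝ)
    {r : ℝ} (hr : 0 ≤ r) : ∑' s, f s * expWeight φ s ≤ ENNReal.ofReal r ↔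
      ∀ F : Finset G, ∑ s ∈ F, (f s).toReal * Real.exp (φ s).toAdd ≤ r := by
  rw [ENNReal.tsum_eq_iSup_sum, iSup_le_iff]
  refine forall_congr' fun F => ?_
  have : ∑ s ∈ F, f s * expWeight φ s =
      ENNReal.ofReal (∑ s ∈ F, (f s).toReal * Real.exp (φ s).toAdd) := by
    rw [ENNReal.ofReal_sum_of_nonneg fun s _ => by positivity]
    refine Finset.sum_congr rfl fun s _ => ?_
    rw [ENNReal.ofReal_mul ENNReal.toReal_nonneg, ENNReal.ofReal_toReal (hf s)]; rfl
  rw [this, ENNReal.ofReal_le_ofReal_iff hr]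

/-- On an amenable group a positive superharmonic function can be averaged to an exponential one:
the mean of `x ↦ log v(g⁻¹x) - log v(x)`, bounded by the Harnack inequality, is additive in `g`, and
convexity of the exponential preserves the superharmonic inequality. -/
lemma exists_character_of_superharmonic (hG : IsAmenable G) {μ : PMF G} (hμ : IsNondegenerate μ)
    {r : ℝ≥0∞} (hr : r ≠ ∞) {v : G → ℝ≥0∞} (hv0 : ∀ x, v x ≠ 0 ∧ v x ≠ ∞)
    (hv : ∀ x, ∑' s, μ s * v (s⁻¹ * x) ≤ r * v x) :
    ∃ φ : G →* Multiplicative ℝ, ∑' s, μ s * expWeight φ s ≤ r := by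
  obtain ⟨M, hM, hinv⟩ := hG.exists_isMean
  set u : G → ℝ := fun x => (v x).toReal with hu
  have hu0 : ∀ x, 0 < u x := fun x => ENNReal.toReal_pos (hv0 x).1 (hv0 x).2
  have hup : ∀ g : G, ∃ C : ℝ, ∀ x, Real.log (u (g⁻¹ * x)) - Real.log (u x) ≤ C := by
    intro g
    obtain ⟨c, hc, hcx⟩ := exists_harnack hμ hr hv g
    refine ⟨Real.log c.toReal, fun x => ?_⟩
    have h1 : u (g⁻¹ * x) ≤ c.toReal * u x := by
      rw [hu, ← ENNReal.toReal_mul]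
      exact ENNReal.toReal_mono (ENNReal.mul_ne_top hc (hv0 x).2) (hcx x)
    have hc0 : 0 < c.toReal := pos_of_mul_pos_left ((hu0 _).trans_le h1) (hu0 x).le
    have := Real.log_le_log (hu0 _) h1
    rw [Real.log_mul hc0.ne' (hu0 x).ne'] at this
    linarith
  have hbdd : ∀ g : G, Memℓp (fun x => Real.log (u (g⁻¹ * x)) - Real.log (u x)) ∞ := by
    intro g
    obtain ⟨C, hC⟩ := hup g
    obtain ⟨D, hD⟩ := hup g⁻¹
    refine memℓp_infty ⟨max C D, ?_⟩
    rintro _ ⟨x, rfl⟩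
    have h1 := hC x
    have h2 := hD (g⁻¹ * x)
    rw [inv_inv, mul_inv_cancel_left] at h2
    exact abs_le.2 ⟨by linarith [le_max_right C D], h1.trans (le_max_left C D)⟩
  set h : G → lp (fun _ : G => ℝ) ∞ := fun g => ⟨_, hbdd g⟩ with hh
  have happ : ∀ g x, h g x = Real.log (u (g⁻¹ * x)) - Real.log (u x) := fun g x => rfl
  have hmul : ∀ a b, h (a * b) = leftTranslate a⁻¹ (h b) + h a := by
    intro a b
    ext x
    simp only [lp.coeFn_add, Pi.add_apply, leftTranslate_apply, happ, mul_inv_rev, mul_assoc]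
    ring
  let φ : G →* Multiplicative ℝ := MonoidHom.mk' (fun g => Multiplicative.ofAdd (M (h g)))
    fun a b => by rw [hmul, map_add, hinv, ofAdd_add, mul_comm]
  have hφ : ∀ g, (φ g).toAdd = M (h g) := fun g => rfl
  refine ⟨φ, ?_⟩
  rw [← ENNReal.ofReal_toReal hr, tsum_mul_expWeight_le_iff μ.apply_ne_top φ ENNReal.toReal_nonneg]
  intro F
  have hF : ∀ x, ∑ s ∈ F, (μ s).toReal * Real.exp (h s x) ≤ r.toReal := by
    intro x
    have h1 : ∑ s ∈ F, (μ s).toReal * u (s⁻¹ * x) ≤ r.toReal * u x := by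
      have := ENNReal.toReal_mono (ENNReal.mul_ne_top hr (hv0 x).2)
        ((ENNReal.sum_le_tsum F).trans (hv x))
      rw [ENNReal.toReal_mul, ENNReal.toReal_sum fun s _ =>
        ENNReal.mul_ne_top (μ.apply_ne_top s) (hv0 _).2] at this
      simpa only [ENNReal.toReal_mul] using this
    have h2 : ∀ s, Real.exp (h s x) = u (s⁻¹ * x) / u x := fun s => by
      rw [happ, Real.exp_sub, Real.exp_log (hu0 _), Real.exp_log (hu0 _)]
    simp_rw [h2, ← mul_div_assoc]
    rwa [← Finset.sum_div, div_le_iff₀ (hu0 x)]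
  -- Jensen's inequality for `M`, through the tangent to the exponential at `φ s`
  have hT := hM (∑ s ∈ F, ((μ s).toReal * Real.exp (φ s).toAdd) •
    ((1 : lp (fun _ : G => ℝ) ∞) + (h s - (φ s).toAdd • (1 : lp (fun _ : G => ℝ) ∞)))) r.toReal
    fun x => by
      refine le_trans ?_ (hF x)
      rw [lp.coeFn_sum, Finset.sum_apply]
      refine Finset.sum_le_sum fun s _ => ?_
      simp only [lp.coeFn_smul, lp.coeFn_add, lp.coeFn_sub, lp.infty_coeFn_one, Pi.smul_apply,
        Pi.add_apply, Pi.sub_apply, Pi.one_apply, smul_eq_mul, mul_one]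
      rw [mul_assoc]
      gcongr
      have := Real.add_one_le_exp (h s x - (φ s).toAdd)
      calc Real.exp (φ s).toAdd * (1 + (h s x - (φ s).toAdd))
          ≤ Real.exp (φ s).toAdd * Real.exp (h s x - (φ s).toAdd) := by gcongr; linarith
        _ = Real.exp (h s x) := by rw [← Real.exp_add]; ring_nf
  simpa [hM.map_one, hφ] using hT

lemma exists_character_of_lt (hG : IsAmenable G) {μ : PMF G} (hμ : IsNondegenerate μ)
    {r : ℝ≥0∞} (hr : r ≠ ∞) (h : walkSpectralRadius μ < r) :
    ∃ φ : G →* Multiplicative ℝ, ∑' s, μ s * expWeight φ s ≤ r := by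
  obtain ⟨v, hv0, hv⟩ := exists_superharmonic hμ hr h
  exact exists_character_of_superharmonic hG hμ hr hv0 hv

/-! ### Spectral radius and exponential weights -/

lemma convPow_mul_expWeight (f : G → ℝ≥0∞) (φ : G →* Multiplicative ℝ) (n : ℕ) (x : G) :
    convPow (fun s => f s * expWeight φ s) n x = convPow f n x * expWeight φ x := by
  induction n generalizing x with
  | zero =>
    by_cases hx : x = 1
    · subst hx; simp [convPow, expWeight_one]
    · simp [convPow, hx]
  | succ n ih =>
    simp only [convPow, conv, ← ENNReal.tsum_mul_right]
    refine tsum_congr fun s => ?_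
    have hx : expWeight φ x = expWeight φ s * expWeight φ (s⁻¹ * x) := by
      rw [← expWeight_mul, mul_inv_cancel_left]
    rw [ih, hx]
    ring

lemma convPow_mul_const (f : G → ℝ≥0∞) (c : ℝ≥0∞) (n : ℕ) (x : G) :
    convPow (fun s => f s * c) n x = convPow f n x * c ^ n := by
  induction n generalizing x with
  | zero => simp [convPow]
  | succ n ih =>
    simp only [convPow, conv, ← ENNReal.tsum_mul_right]
    refine tsum_congr fun s => ?_
    rw [ih]
    ring

lemma tsum_convPow (f : G → ℝ≥0∞) (n : ℕ) : ∑' x, convPow f n x = (∑' s, f s) ^ n := by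
  induction n with
  | zero =>
    rw [pow_zero, tsum_eq_single 1 fun x hx => by simp [convPow, hx]]
    simp [convPow]
  | succ n ih =>
    simp only [convPow, conv]
    rw [ENNReal.tsum_comm, pow_succ', ← ENNReal.tsum_mul_right]
    refine tsum_congr fun s => ?_
    rw [ENNReal.tsum_mul_left, ← ih]
    congr 1
    exact (Equiv.mulLeft s⁻¹).tsum_eq (convPow f n)

lemma walkSpectralRadius_le_of_convPow_le {μ : PMF G} {r : ℝ≥0∞}
    (h : ∀ n, convPow μ n 1 ≤ r ^ n) : walkSpectralRadius μ ≤ r := by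
  refine limsup_le_of_le (h := ?_)
  filter_upwards [eventually_gt_atTop 0] with n hn
  rw [one_div, ENNReal.rpow_inv_le_iff (by exact_mod_cast hn), ENNReal.rpow_natCast]
  exact h n

lemma walkSpectralRadius_le_one (μ : PMF G) : walkSpectralRadius μ ≤ 1 :=
  walkSpectralRadius_le_of_convPow_le fun n => by
    simpa using convPow_le_one μ.tsum_coe.le n 1

/-- The exponential moments of `μ` bound the spectral radius, since a character takes the value
`1` at the identity. -/
lemma walkSpectralRadius_le_of_character {μ : PMF G} {r : ℝ≥0∞} {φ : G →* Multiplicative ℝ}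
    (h : ∑' s, μ s * expWeight φ s ≤ r) : walkSpectralRadius μ ≤ r := by
  refine walkSpectralRadius_le_of_convPow_le fun n => ?_
  calc convPow μ n 1 = convPow (fun s => μ s * expWeight φ s) n 1 := by
        rw [convPow_mul_expWeight, expWeight_one, mul_one]
    _ ≤ ∑' x, convPow (fun s => μ s * expWeight φ s) n x := ENNReal.le_tsum 1
    _ = (∑' s, μ s * expWeight φ s) ^ n := tsum_convPow _ n
    _ ≤ r ^ n := by gcongr

/-- On an amenable group the infimum of the exponential moments of `μ` is attained at the spectral
radius: the characters obtained above the spectral radius are pointwise bounded by nondegeneracy,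
and any pointwise cluster point of them will do. -/
lemma exists_character_le_walkSpectralRadius (hG : IsAmenable G) {μ : PMF G}
    (hμ : IsNondegenerate μ) :
    ∃ φ : G →* Multiplicative ℝ, ∑' s, μ s * expWeight φ s ≤ walkSpectralRadius μ := by
  have hl : walkSpectralRadius μ ≠ ∞ :=
    ((walkSpectralRadius_le_one μ).trans_lt ENNReal.one_lt_top).ne
  set l : ℝ := (walkSpectralRadius μ).toReal with hldef
  have hl0 : 0 ≤ l := ENNReal.toReal_nonneg
  have hlt : ∀ n : ℕ, walkSpectralRadius μ < ENNReal.ofReal (l + 1 / ((n : ℝ) + 1)) := by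
    intro n
    rw [ENNReal.lt_ofReal_iff_toReal_lt hl]
    have : (0 : ℝ) < 1 / ((n : ℝ) + 1) := by positivity
    linarith
  choose φ hφ using fun n : ℕ =>
    exists_character_of_lt hG hμ ENNReal.ofReal_ne_top (hlt n)
  have hfin : ∀ (n : ℕ) (F : Finset G),
      ∑ s ∈ F, (μ s).toReal * Real.exp (φ n s).toAdd ≤ l + 1 / ((n : ℝ) + 1) := fun n =>
    (tsum_mul_expWeight_le_iff μ.apply_ne_top (φ n) (by positivity)).1 (hφ n)
  have hup : ∀ g : G, ∃ C : ℝ, ∀ n, (φ n g).toAdd ≤ C := by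
    intro g
    have hg : g ∈ Subsemigroup.closure μ.support := by rw [hμ]; trivial
    induction hg using Subsemigroup.closure_induction with
    | mem s hs =>
      have hs0 : 0 < (μ s).toReal :=
        ENNReal.toReal_pos ((μ.mem_support_iff s).1 hs) (μ.apply_ne_top s)
      refine ⟨(l + 1) / (μ s).toReal, fun n => ?_⟩
      have h1 := hfin n {s}
      rw [Finset.sum_singleton] at h1
      have h2 : 1 / ((n : ℝ) + 1) ≤ 1 := by
        rw [div_le_one (by positivity)]; linarith [(Nat.cast_nonneg n : (0 : ℝ) ≤ n)]
      have h3 := Real.add_one_le_exp (φ n s).toAdd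
      rw [le_div_iff₀ hs0]
      nlinarith
    | mul a b _ _ ha hb =>
      obtain ⟨C, hC⟩ := ha
      obtain ⟨D, hD⟩ := hb
      exact ⟨C + D, fun n => by rw [map_mul, toAdd_mul]; exact add_le_add (hC n) (hD n)⟩
  have hbdd : ∀ g : G, ∃ C : ℝ, ∀ n, |(φ n g).toAdd| ≤ C := by
    intro g
    obtain ⟨C, hC⟩ := hup g
    obtain ⟨D, hD⟩ := hup g⁻¹
    refine ⟨max C D, fun n => abs_le.2 ⟨?_, (hC n).trans (le_max_left C D)⟩⟩
    have := hD n
    rw [map_inv, toAdd_inv] at this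
    linarith [le_max_right C D]
  choose C hC using hbdd
  choose L hL using fun g => exists_tendsto_ultrafilter (hyperfilter ℕ) (hC g)
  let ψ : G →* Multiplicative ℝ := MonoidHom.mk' (fun g => Multiplicative.ofAdd (L g))
    fun a b => by
      rw [← ofAdd_add]
      congr 1
      exact tendsto_nhds_unique (hL (a * b)) (by simpa using (hL a).add (hL b))
  refine ⟨ψ, ?_⟩
  rw [← ENNReal.ofReal_toReal hl, tsum_mul_expWeight_le_iff μ.apply_ne_top ψ hl0]
  intro F
  have h1 : Tendsto (fun n => ∑ s ∈ F, (μ s).toReal * Real.exp (φ n s).toAdd) (hyperfilter ℕ)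
      (nhds (∑ s ∈ F, (μ s).toReal * Real.exp (ψ s).toAdd)) :=
    tendsto_finsetSum _ fun s _ => ((Real.continuous_exp.tendsto _).comp (hL s)).const_mul _
  have h2 : Tendsto (fun n : ℕ => l + 1 / ((n : ℝ) + 1)) (hyperfilter ℕ) (nhds l) := by
    simpa using (tendsto_one_div_add_atTop_nhds_zero_nat.mono_left
      Nat.hyperfilter_le_atTop).const_add l
  exact le_of_tendsto_of_tendsto' h1 h2 fun n => hfin n F

/-! ### Push-forward of the walk to a quotient -/

variable {H : Type u} [Group H]

lemma tsum_map_mul {α β : Type*} (μ : PMF α) (π : α → β) (h : β → ℝ≥0∞) :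
    ∑' m, μ.map π m * h m = ∑' g, μ g * h (π g) := by
  classical
  simp_rw [PMF.map_apply, ← ENNReal.tsum_mul_right]
  rw [ENNReal.tsum_comm]
  refine tsum_congr fun g => ?_
  rw [tsum_eq_single (π g) fun m hm => by simp [hm]]
  simp

lemma convPow_le_convPow_map (μ : PMF G) (π : G →* H) (n : ℕ) (x : G) :
    convPow μ n x ≤ convPow (μ.map π) n (π x) := by
  induction n generalizing x with
  | zero =>
    by_cases hx : x = 1
    · subst hx; simp [convPow]
    · simp [convPow, hx]
  | succ n ih =>
    simp only [convPow, conv]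
    rw [tsum_map_mul μ π fun m => convPow (μ.map π) n (m⁻¹ * π x)]
    refine ENNReal.tsum_le_tsum fun s => ?_
    rw [← map_inv, ← map_mul]
    gcongr
    exact ih _

lemma walkSpectralRadius_le_map (μ : PMF G) (π : G →* H) :
    walkSpectralRadius μ ≤ walkSpectralRadius (μ.map π) := by
  refine limsup_le_limsup (Eventually.of_forall fun n => ?_)
  refine ENNReal.rpow_le_rpow ?_ (by positivity)
  simpa using convPow_le_convPow_map μ π n 1

lemma IsNondegenerate.map {μ : PMF G} (hμ : IsNondegenerate μ) {π : G →* H}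
    (hπ : Function.Surjective π) : IsNondegenerate (μ.map π) := by
  rw [IsNondegenerate, PMF.support_map]
  have h := MulHom.map_mclosure (π : G →ₙ* H) μ.support
  rw [show Subsemigroup.closure μ.support = ⊤ from hμ] at h
  refine h.symm.trans ?_
  rw [eq_top_iff]
  intro m _
  obtain ⟨g, rfl⟩ := hπ m
  exact ⟨g, trivial, rfl⟩

lemma proj_surjective : Function.Surjective (proj G) :=
  (QuotientGroup.mk'_surjective _).comp (QuotientGroup.mk'_surjective _)

/-- Real characters factor through the torsion-free abelianisation. -/
lemma exists_comp_proj_eq (φ : G →* Multiplicative ℝ) :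
    ∃ ψ : TorsionFreeAb G →* Multiplicative ℝ, ψ.comp (proj G) = φ := by
  refine ⟨QuotientGroup.lift _ (Abelianization.lift φ) fun a ha => ?_, ?_⟩
  · obtain ⟨n, hn, han⟩ := isOfFinOrder_iff_pow_eq_one.1 ((CommGroup.mem_torsion _).1 ha)
    have h1 : n • (Abelianization.lift φ a).toAdd = 0 := by
      rw [← toAdd_pow, ← map_pow, han, map_one, toAdd_one]
    exact Multiplicative.toAdd.injective
      ((smul_eq_zero.1 h1).resolve_left hn.ne')
  · ext g
    simp [proj]

end RandomWalk
end

/-! ### Amenability and the torsion-free abelianisation -/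

open RandomWalk in
theorem theorem1p1 {G : Type*} [Group G] [Group.FG G] (μ : PMF G)
    (hμ : RandomWalk.IsNondegenerate μ) :
    RandomWalk.IsAmenable G ↔
      RandomWalk.walkSpectralRadius μ =
        RandomWalk.walkSpectralRadius (μ.map (RandomWalk.proj G)) := by
  constructor
  · intro hG
    refine le_antisymm (walkSpectralRadius_le_map μ (proj G)) (le_of_forall_gt_imp_ge_of_dense ?_)
    intro r hr
    by_cases hrt : r = ∞
    · simp [hrt]
    obtain ⟨φ, hφ⟩ := exists_character_of_lt hG hμ hrt hr
    obtain ⟨ψ, rfl⟩ := exists_comp_proj_eq φ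
    refine walkSpectralRadius_le_of_character (φ := ψ) ?_
    rwa [tsum_map_mul μ (proj G)]
  · intro heq
    have hab : IsAmenable (TorsionFreeAb G) := by
      have : Group.FG (TorsionFreeAb G) := Group.fg_of_surjective proj_surjective
      exact isAmenable_of_commGroup _
    obtain ⟨ψ, hψ⟩ := exists_character_le_walkSpectralRadius hab (hμ.map proj_surjective)
    rw [← heq, tsum_map_mul μ (proj G)] at hψ
    set φ := ψ.comp (proj G)
    replace hψ : ∑' g, μ g * expWeight φ g ≤ walkSpectralRadius μ := hψ
    set l := walkSpectralRadius μ with hl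
    have hlt : l ≠ ∞ := ((walkSpectralRadius_le_one μ).trans_lt ENNReal.one_lt_top).ne
    have hl0 : l ≠ 0 := by
      obtain ⟨s, hs⟩ := μ.support_nonempty
      refine (lt_of_lt_of_le ?_ ((ENNReal.le_tsum s).trans hψ)).ne'
      exact pos_iff_ne_zero.2 (mul_ne_zero ((μ.mem_support_iff s).1 hs) (expWeight_ne_zero φ s))
    -- the walk tilted by `φ` and normalised by the spectral radius
    refine isAmenable_of_one_le_limsup (f := fun g => μ g * expWeight φ g * l⁻¹) ?_ ?_ ?_
    · rw [ENNReal.tsum_mul_right, ← div_eq_mul_inv]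
      exact ENNReal.div_le_of_le_mul (by simpa using hψ)
    · have hsupp : (Function.support fun g => μ g * expWeight φ g * l⁻¹) = μ.support := by
        ext g
        simp [expWeight_ne_zero, hlt]
      rw [hsupp, eq_top_iff]
      intro g _
      have hg : g ∈ Subsemigroup.closure μ.support := by rw [hμ]; trivial
      exact (Subsemigroup.closure_le
        (S := (Subgroup.closure μ.support).toSubsemigroup)).2 Subgroup.subset_closure hg
    · have hev : ∀ᶠ n : ℕ in atTop,
          convPow (fun g => μ g * expWeight φ g * l⁻¹) n 1 ^ (1 / (n : ℝ)) =
            l⁻¹ * convPow μ n 1 ^ (1 / (n : ℝ)) := by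
        filter_upwards [eventually_gt_atTop 0] with n hn
        have hn' : (n : ℝ) ≠ 0 := by exact_mod_cast hn.ne'
        rw [convPow_mul_const, convPow_mul_expWeight, expWeight_one, mul_one,
          ENNReal.mul_rpow_of_nonneg _ _ (by positivity), ← ENNReal.rpow_natCast,
          ← ENNReal.rpow_mul, mul_one_div_cancel hn', ENNReal.rpow_one, mul_comm]
      rw [limsup_congr hev, ENNReal.limsup_const_mul_of_ne_top (ENNReal.inv_ne_top.2 hl0)]
      exact (ENNReal.inv_mul_cancel hl0 hlt).ge
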